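/- **Model and notions.** Fix constants: a dimension $d\ge 3$, a number $k\ge 0$ of extra words per node, an exponent $\alpha\in(0,1)$, and $a,b>0$. *Implicit grid graph.* An implicit graph $G=(V,\mathcal E)$ consists of a finite set $V\subset\mathbb N^d$ of nodes, each carrying $k$ extra words of information, and a symmetric edge formation rule $\mathcal E$, which decides, from the coordinates and the extra words of two distinct nodes $u,v$ only, whether $\{u,v\}$ is an edge (and possibly gives its weight). It is an implicit $(d,c)$-grid graph if $0<\|u-v\|_\infty\le c$ for every edge $\{u,v\}$. *Pseudo $s$-separator.* For $1\le s<|V|$, a set $S\subseteq V$ is a pseudo $s$-separator of $G$ with constant $K$ if (i) $|S|\le K\cdot\frac{c\,|V|}{s^{1/d}}\cdot\log s$, and (ii) $V\setminus S$ is the union of $h\le K|V|/s$ pairwise disjoint sets $V_1,\dots,V_h$ with $|V_i|\le K s$, and no edge of $G$ joins two distinct $V_i,V_j$. *MPC.* There are $m=\lceil |V|/s\rceil$ machines, each with a memory of $Cs$ words of $w$ bits, where $|V|\le 2^w$ and each coordinate and each extra word fits into one word. Initially each node, with its coordinates and its extra words, is stored on exactly one machine, at most $s$ nodes per machine, arbitrarily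 otherwise. In each synchronous round, every machine first sends and receives messages, at most $Cs$ words sent and at most $Cs$ words received, and then performs an arbitrary local computation on its memory, the received messages and $Cs$ private, uniform random words. At the end every machine holds either a failure flag or a success flag followed by a list of points; the output is the set of all listed points. **Theorem.** There are integers $C,R$ and reals $K,\gamma>0$, depending only on $d,k,\alpha,a,b$, and an MPC algorithm (given the parameters $|V|,s,c,w$) such that the following holds for all integers $s,c$, all $w$, and every implicit $(d,c)$-grid graph $G=(V,\mathcal E)$ with $$a|V|^\alpha\le s\le b|V|^\alpha,\qquad s<|V|,\qquad 1\le c\le s^{1/d^3}.$$ On every initial distribution of the nodes, the algorithm runs for $R=O(1)$ rounds, in every run respects the memory and communication limits, and is Las Vegas: in every run either all machines report failure, or the output is a pseudo $s$-separator of $G$ with constant $K$; and the latter happens with probability at least $1-|V|^{-\gamma}$. -/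

import Mathlib

/-! ### Implicit grid graphs -/

/-- The information attached to a node: its `d` coordinates and `k` further words. -/
abbrev NodeRecord (d k : ℕ) : Type := (Fin d → ℕ) × (Fin k → ℕ)

/-- An implicit (undirected) graph whose nodes are distinct points of `ℕ^d`. Every node carries
`k` further words of information. The edge formation rule looks only at the records of two nodes;
`none` means "no edge", `some none` "an edge without a weight", `some (some x)` "an edge of
weight `x`". -/
structure ImplicitGraph (d k : ℕ) where
  nodes : Finset (Fin d → ℕ)
  info : (Fin d → ℕ) → Fin k → ℕ
  rule : NodeRecord d k → NodeRecord d k → Option (Option ℝ)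
  rule_symm : ∀ u ∈ nodes, ∀ v ∈ nodes, u ≠ v →
    rule (u, info u) (v, info v) = rule (v, info v) (u, info u)

namespace ImplicitGraph

variable {d k : ℕ}

/-- The explicit graph obtained by materialising all the edges. -/
def explicit (G : ImplicitGraph d k) : SimpleGraph {v // v ∈ G.nodes} where
  Adj u v := u ≠ v ∧ (G.rule (u.1, G.info u.1) (v.1, G.info v.1)).isSome
  symm := ⟨fun u v h => ⟨h.1.symm, by
    rw [G.rule_symm v.1 v.2 u.1 u.2 (fun e => h.1 (Subtype.ext e.symm))]
    exact h.2⟩⟩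
  loopless := ⟨fun _ h => h.1 rfl⟩

/-- The explicit graph is a `(d,c)`-grid graph. The distance on `Fin d → ℕ` is the
`ℓ_∞`-distance. -/
def IsGridGraph (G : ImplicitGraph d k) (c : ℕ) : Prop :=
  ∀ u v, G.explicit.Adj u v → 0 < dist u.1 v.1 ∧ dist u.1 v.1 ≤ (c : ℝ)

/-- Every coordinate and every further piece of information fits into one `w`-bit word. -/
def FitsWords (G : ImplicitGraph d k) (w : ℕ) : Prop :=
  ∀ v ∈ G.nodes, (∀ i, v i < 2 ^ w) ∧ ∀ j, G.info v j < 2 ^ w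

/-- The record of a node as a list of `d + k` words. -/
def encodeNode (G : ImplicitGraph d k) (v : Fin d → ℕ) : List ℕ :=
  List.ofFn v ++ List.ofFn (G.info v)

/-- `S` is a pseudo `s`-separator of the `(d,c)`-grid graph `G`, with `K` as the constant in all
the asymptotic bounds: `|S| ≤ K · (c|V| / s^{1/d}) · log s`, and `V \ S` splits into `h ≤ K|V|/s`
pairwise disjoint parts of at most `K s` nodes, with no edge of `G` between distinct parts. -/
def IsPseudoSeparator (G : ImplicitGraph d k) (c s : ℕ) (K : ℝ)
    (S : Finset (Fin d → ℕ)) : Prop :=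
  S ⊆ G.nodes ∧
  (S.card : ℝ) ≤
    K * (((c : ℝ) * (G.nodes.card : ℝ) / (s : ℝ) ^ ((1 : ℝ) / (d : ℝ))) * Real.log (s : ℝ)) ∧
  ∃ (h : ℕ) (part : Fin h → Finset (Fin d → ℕ)),
    (h : ℝ) ≤ K * ((G.nodes.card : ℝ) / (s : ℝ)) ∧
    (∀ i j, i ≠ j → Disjoint (part i) (part j)) ∧
    (∀ v, v ∈ G.nodes \ S ↔ ∃ i, v ∈ part i) ∧
    (∀ i, ((part i).card : ℝ) ≤ K * (s : ℝ)) ∧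
    (∀ i j, i ≠ j → ∀ u v : {v // v ∈ G.nodes},
      u.1 ∈ part i → v.1 ∈ part j → ¬ G.explicit.Adj u v)

end ImplicitGraph

/-! ### The MPC model -/

/-- The number of machines for `n` nodes when each machine takes `s` of them. -/
def machineCount (n s : ℕ) : ℕ := n ⌈/⌉ s

/-- The random words that one machine draws in one round. -/
abbrev MPCCoins (mem w : ℕ) : Type := Fin mem → Fin (2 ^ w)

/-- A randomized MPC algorithm on `m` machines whose local memory consists of `mem` words of
`w` bits. `step t i M inbox r` is the computation phase of machine `i` in round `t`: from its
memory `M`, the messages it has just received (`inbox j` comes from machine `j`) and its private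
random words `r`, it computes its new memory and the messages that it will send in the
communication phase of the next round (addressed by receiver). -/
structure MPCAlgorithm (m mem w : ℕ) where
  step : ℕ → Fin m → List ℕ → (Fin m → List ℕ) → MPCCoins mem w → List ℕ × (Fin m → List ℕ)

/-- The state of the system after a round: for each machine, its memory and the outgoing messages
that it has prepared. -/
abbrev MPCConfig (m : ℕ) : Type := Fin m → List ℕ × (Fin m → List ℕ)

/-- All the random words drawn during `R` rounds. -/
abbrev MPCTape (m mem w R : ℕ) : Type := Fin R → Fin m → MPCCoins mem w

/-- The probability of an event when all the random words are independent and uniform. -/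
noncomputable def MPCTape.prob {m mem w R : ℕ} (E : MPCTape m mem w R → Prop) : ℝ :=
  (Nat.card {ω : MPCTape m mem w R // E ω} : ℝ) / (Nat.card (MPCTape m mem w R) : ℝ)

/-- A list of words that fits into `mem` words of `w` bits. -/
def FitsMemory (mem w : ℕ) (l : List ℕ) : Prop :=
  l.length ≤ mem ∧ ∀ x ∈ l, x < 2 ^ w

/-- No machine exceeds its memory, and none sends or receives more than `mem` words in total. -/
def MPCConfig.WithinLimits {m : ℕ} (mem w : ℕ) (σ : MPCConfig m) : Prop :=
  ∀ i, FitsMemory mem w (σ i).1 ∧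
    (∀ j, FitsMemory mem w ((σ i).2 j)) ∧
    ∑ j, ((σ i).2 j).length ≤ mem ∧
    ∑ j, ((σ j).2 i).length ≤ mem

/-- Every machine reports failure: its memory is the single word `0`. -/
def MPCConfig.Failed {m : ℕ} (σ : MPCConfig m) : Prop :=
  ∀ i, (σ i).1 = [0]

/-- The machines jointly output the set of points `S`: the memory of each machine is the word `1`
followed by the coordinates of some points, and `S` consists of the points held by the machines. -/
def MPCConfig.Outputs {m d : ℕ} (σ : MPCConfig m) (S : Finset (Fin d → ℕ)) : Prop :=
  ∃ L : Fin m → List (Fin d → ℕ),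
    (∀ i, (σ i).1 = 1 :: (L i).flatMap (fun v => List.ofFn v)) ∧ ∀ v, v ∈ S ↔ ∃ i, v ∈ L i

/-- The configuration after `R` rounds on initial memories `x`. In each round the communication
phase delivers the prepared messages, and then every machine computes locally. -/
def MPCAlgorithm.run {m mem w : ℕ} (A : MPCAlgorithm m mem w) (x : Fin m → List ℕ) :
    (R : ℕ) → MPCTape m mem w R → MPCConfig m
  | 0, _ => fun i => (x i, fun _ => [])
  | R + 1, ω => fun i =>
      let σ := MPCAlgorithm.run A x R (fun t => ω t.castSucc)
      A.step R i (σ i).1 (fun j => (σ j).2 i) (ω (Fin.last R) i)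

/-- `load` distributes the points of `V` among `m` machines, at most `s` to each: every point is
stored exactly once, and in an arbitrary order. -/
def IsPlacement {d m : ℕ} (V : Finset (Fin d → ℕ)) (s : ℕ)
    (load : Fin m → List (Fin d → ℕ)) : Prop :=
  (∀ i, (load i).length ≤ s ∧ (load i).Nodup) ∧
  (∀ v, v ∈ V ↔ ∃ i, v ∈ load i) ∧
  (∀ i j v, v ∈ load i → v ∈ load j → i = j)

/-- On every admissible distribution of `G` among the machines, `A` computes within `R` rounds a
pseudo `s`-separator of `G` in the Las Vegas sense: the memory and communication limits are
respected in every run; in every run, either all machines report failure, or they output a pseudo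
`s`-separator; and the latter happens with probability at least `1 - δ`. -/
def LasVegasComputesSeparator {d k m mem w : ℕ} (A : MPCAlgorithm m mem w) (R : ℕ)
    (G : ImplicitGraph d k) (c s : ℕ) (K δ : ℝ) : Prop :=
  ∀ load : Fin m → List (Fin d → ℕ), IsPlacement G.nodes s load →
    let x : Fin m → List ℕ := fun i => (load i).flatMap G.encodeNode
    (∀ t ≤ R, ∀ ω : MPCTape m mem w t, (A.run x t ω).WithinLimits mem w) ∧
    (∀ ω : MPCTape m mem w R, (A.run x R ω).Failed ∨
      ∃ S, (A.run x R ω).Outputs S ∧ G.IsPseudoSeparator c s K S) ∧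
    1 - δ ≤ MPCTape.prob (fun ω : MPCTape m mem w R =>
      ∃ S, (A.run x R ω).Outputs S ∧ G.IsPseudoSeparator c s K S)

/-! The separator consists of the nodes in the walls, of thickness `c`, of a cubic grid of mesh `l =
⌊s^(1/d)⌋` shifted by `τ` along every axis. No edge leads from cell to cell outside the walls
(`gridCell_eq_of_dist_le`), and a cell has at most `l^d ≤ s` points, so greedy packing of the cells
gives `O(n/s)` parts of at most `2s` nodes (`card_bin_le`). On average over the `l` shifts, at most
`dcn/l` nodes lie in walls, so some shift is good (`exists_shift_card_inWall_le`).

There are only `l ≤ √s` shifts, so all of them are tried and no sampling is needed. The vectors of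
`l` counts are added up along a tree of degree `√s + 1`, where a machine receives at most `2s`
words. Constant depth `T` suffices because `n ≤ (√s + 1)^T` (`le_sqrt_succ_pow`). The root
broadcasts the best shift, and each machine outputs its own wall nodes. The algorithm is
deterministic and never fails, which is a special case of Las Vegas.

Two boundary effects remain. Counts must fit into a word, so they are capped at `2^w - 1`, which
costs at most a factor 2 (`card_walls_le`). For `s = 1` the factor `log s` vanishes and the
separator must be empty, but then `n ≤ 2^T` is bounded. -/

/-! ### Packing fibres into bins -/

/-- The fibres of `f`, in the order of their values, are packed greedily into bins of size about
`s`; this is the bin of `v`. -/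
def binIndex {β : Type*} (V : Finset β) (f : β → ℕ) (s : ℕ) (v : β) : ℕ :=
  (V.filter (fun u => f u < f v)).card / s

theorem binIndex_lt {β : Type*} {V : Finset β} (f : β → ℕ) (s : ℕ) {v : β} :
    binIndex V f s v < V.card / s + 1 :=
  Nat.lt_succ_of_le (Nat.div_le_div_right (Finset.card_filter_le _ _))

theorem binIndex_congr {β : Type*} (V : Finset β) (f : β → ℕ) (s : ℕ) {u v : β}
    (h : f u = f v) : binIndex V f s u = binIndex V f s v := by
  simp only [binIndex, h]

/-- Members of bin `j` have at least `j s` and fewer than `(j+1) s` predecessors. Hence fewer than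
`s` of them lie strictly below the top value of `f` in the bin, and the top fibre adds at most `s`.
-/
theorem card_bin_le {β : Type*} (V : Finset β) (f : β → ℕ) {s : ℕ} (hs : 0 < s)
    (hf : ∀ q, (V.filter (fun u => f u = q)).card ≤ s) (j : ℕ) :
    (V.filter (fun v => binIndex V f s v = j)).card ≤ 2 * s := by
  classical
  rcases (V.filter (fun v => binIndex V f s v = j)).eq_empty_or_nonempty with h0 | hne
  · rw [h0]; simp
  obtain ⟨x, hx, hxmin⟩ := Finset.exists_min_image _ f hne
  obtain ⟨y, hy, hymax⟩ := Finset.exists_max_image _ f hne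
  have hxy : f x ≤ f y := hxmin y hy
  have hsub : V.filter (fun v => binIndex V f s v = j) ⊆
      (V.filter (fun u => f u < f y) \ V.filter (fun u => f u < f x)) ∪
        V.filter (fun u => f u = f y) := by
    intro v hv
    have h1 := hxmin v hv
    have h2 := hymax v hv
    have h3 := (Finset.mem_filter.1 hv).1
    simp only [Finset.mem_union, Finset.mem_sdiff, Finset.mem_filter, h3, true_and]
    omega
  have hle := Finset.card_le_card hsub
  have hu := Finset.card_union_le
    (V.filter (fun u => f u < f y) \ V.filter (fun u => f u < f x)) (V.filter (fun u => f u = f y))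
  have hd : (V.filter (fun u => f u < f y) \ V.filter (fun u => f u < f x)).card =
      (V.filter (fun u => f u < f y)).card - (V.filter (fun u => f u < f x)).card :=
    Finset.card_sdiff_of_subset (Finset.monotone_filter_right V (fun u _ hu => lt_of_lt_of_le hu hxy))
  have hq := hf (f y)
  have ex : (V.filter (fun u => f u < f x)).card / s = j := (Finset.mem_filter.1 hx).2
  have ey : (V.filter (fun u => f u < f y)).card / s = j := (Finset.mem_filter.1 hy).2
  have bx := Nat.div_mul_le_self (V.filter (fun u => f u < f x)).card s
  have byy := Nat.lt_mul_div_succ (V.filter (fun u => f u < f y)).card hs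
  rw [ex] at bx
  rw [ey, mul_comm, Nat.succ_mul] at byy
  omega

/-! ### The walls of a shifted grid -/

/-- The point `v` lies in one of the walls, of thickness `c`, of the grid of mesh `l` shifted by
`τ`. -/
def InWall {d : ℕ} (l c τ : ℕ) (v : Fin d → ℕ) : Prop :=
  ∃ a, (v a + τ) % l < c

instance {d : ℕ} (l c τ : ℕ) : DecidablePred (InWall (d := d) l c τ) :=
  fun v => inferInstanceAs (Decidable (∃ a, (v a + τ) % l < c))

/-- The cell of `v` in the grid of mesh `l` shifted by `τ`. -/
def gridCell {d : ℕ} (l τ : ℕ) (v : Fin d → ℕ) : Fin d → ℕ :=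
  fun a => (v a + τ) / l

/-- Inside a fixed cell, a point is determined by its residues modulo `l`. -/
theorem card_gridCell_le {d : ℕ} (V : Finset (Fin d → ℕ)) {l : ℕ} (hl : 0 < l) (τ : ℕ)
    (q : Fin d → ℕ) : (V.filter (fun v => gridCell l τ v = q)).card ≤ l ^ d := by
  have h : (Fintype.piFinset (fun _ : Fin d => Finset.range l)).card = l ^ d := by simp
  rw [← h]
  refine Finset.card_le_card_of_injOn (fun v a => (v a + τ) % l) ?_ ?_
  · intro v _
    simp only [Finset.mem_coe, Fintype.mem_piFinset, Finset.mem_range]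
    exact fun a => Nat.mod_lt _ hl
  · intro u hu v hv huv
    have hu' := (Finset.mem_filter.1 (Finset.mem_coe.1 hu)).2
    have hv' := (Finset.mem_filter.1 (Finset.mem_coe.1 hv)).2
    funext a
    have h1 : (u a + τ) / l = (v a + τ) / l := congrFun (hu'.trans hv'.symm) a
    have h2 : (u a + τ) % l = (v a + τ) % l := congrFun huv a
    have h3 := Nat.div_add_mod (u a + τ) l
    have h4 := Nat.div_add_mod (v a + τ) l
    rw [h1, h2] at h3
    omega

/-- A wall occupies the lowest `c` layers of a cell. Moving up across a cell boundary by at most `c`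
therefore ends in a wall. -/
theorem gridCell_eq_of_dist_le {d l c τ : ℕ} (hl : 0 < l) {u v : Fin d → ℕ}
    (hu : ¬ InWall l c τ u) (hv : ¬ InWall l c τ v) (h : dist u v ≤ (c : ℝ)) :
    gridCell l τ u = gridCell l τ v := by
  have key : ∀ x y : ℕ, c ≤ y % l → y ≤ x + c → y / l ≤ x / l := by
    intro x y hy hxy
    by_contra! hlt
    have h1 := Nat.lt_mul_of_div_lt hlt hl
    have h2 := Nat.div_add_mod y l
    rw [mul_comm] at h1
    omega
  simp only [InWall, not_exists, not_lt] at hu hv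
  funext a
  have hd : |((u a : ℕ) : ℝ) - (v a : ℝ)| ≤ c := by
    rw [← Nat.dist_eq]; exact (dist_le_pi_dist u v a).trans h
  rw [abs_le] at hd
  have h1 : u a ≤ v a + c := by
    have : (u a : ℝ) ≤ ((v a + c : ℕ) : ℝ) := by push_cast; linarith
    exact_mod_cast this
  have h2 : v a ≤ u a + c := by
    have : (v a : ℝ) ≤ ((u a + c : ℕ) : ℝ) := by push_cast; linarith
    exact_mod_cast this
  exact le_antisymm (key _ _ (hu a) (by omega)) (key _ _ (hv a) (by omega))

/-- Distinct shifts below `l` give distinct residues of `x + τ`. -/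
theorem card_shifts_le (l c x : ℕ) :
    ((Finset.range l).filter (fun τ => (x + τ) % l < c)).card ≤ c := by
  conv_rhs => rw [← Finset.card_range c]
  refine Finset.card_le_card_of_injOn (fun τ => (x + τ) % l) ?_ ?_
  · intro τ hτ
    simp only [Finset.coe_filter, Set.mem_ofPred_eq] at hτ
    simpa using hτ.2
  · intro τ hτ τ' hτ' h
    simp only [Finset.coe_filter, Finset.mem_range, Set.mem_ofPred_eq] at hτ hτ'
    have h1 : x + τ ≡ x + τ' [MOD l] := h
    exact (Nat.ModEq.add_left_cancel' x h1).eq_of_lt_of_lt hτ.1 hτ'.1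

/-- Some shift puts few points into walls. -/
theorem exists_shift_card_inWall_le {d : ℕ} (V : Finset (Fin d → ℕ)) {l : ℕ} (hl : 0 < l)
    (c : ℕ) : ∃ τ < l, l * (V.filter (InWall l c τ)).card ≤ V.card * (d * c) := by
  -- Double counting: for each point and each of the `d` axes, at most `c` shifts are bad.
  have hsum : ∑ τ ∈ Finset.range l, (V.filter (InWall l c τ)).card ≤ V.card * (d * c) := by
    have h1 : ∀ τ ∈ Finset.range l, (V.filter (InWall l c τ)).card ≤
        ∑ v ∈ V, ∑ a : Fin d, if (v a + τ) % l < c then 1 else 0 := by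
      intro τ _
      rw [Finset.card_filter]
      refine Finset.sum_le_sum fun v _ => ?_
      split_ifs with h
      · obtain ⟨a, ha⟩ := h
        refine le_trans ?_ (Finset.single_le_sum (fun _ _ => Nat.zero_le _) (Finset.mem_univ a))
        simp [ha]
      · exact Nat.zero_le _
    refine (Finset.sum_le_sum h1).trans ?_
    rw [Finset.sum_comm, ← smul_eq_mul]
    refine Finset.sum_le_card_nsmul _ _ _ fun v _ => ?_
    rw [Finset.sum_comm]
    refine (Finset.sum_le_card_nsmul _ _ c fun a _ => ?_).trans (by simp)
    rw [← Finset.card_filter]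
    exact card_shifts_le l c (v a)
  by_contra! hcon
  have h2 : ∑ _τ ∈ Finset.range l, V.card * (d * c) <
      ∑ τ ∈ Finset.range l, l * (V.filter (InWall l c τ)).card :=
    Finset.sum_lt_sum_of_nonempty ⟨0, Finset.mem_range.2 hl⟩
      fun τ hτ => hcon τ (Finset.mem_range.1 hτ)
  rw [Finset.sum_const, Finset.card_range, smul_eq_mul, ← Finset.mul_sum] at h2
  exact absurd (Nat.mul_le_mul_left l hsum) (not_le.2 h2)

/-! ### Separators from walls -/

namespace ImplicitGraph

variable {d k : ℕ}

/-- The cells of the grid, packed into bins, are separated by the walls. -/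
theorem isPseudoSeparator_of_walls (G : ImplicitGraph d k) {c s l τ : ℕ} {K : ℝ}
    (hG : G.IsGridGraph c) (hs : 0 < s) (hsn : s ≤ G.nodes.card) (hl : 0 < l) (hls : l ^ d ≤ s)
    (hK : 2 ≤ K)
    (hS : ((G.nodes.filter (InWall l c τ)).card : ℝ) ≤
      K * (((c : ℝ) * (G.nodes.card : ℝ) / (s : ℝ) ^ ((1 : ℝ) / (d : ℝ))) * Real.log (s : ℝ))) :
    G.IsPseudoSeparator c s K (G.nodes.filter (InWall l c τ)) := by
  classical
  set V := G.nodes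
  -- The order of the cells is irrelevant; injectivity of the encoding makes each fibre a single
  -- cell.
  set f : (Fin d → ℕ) → ℕ := fun v => Encodable.encode (gridCell l τ v) with hf
  set S := V.filter (InWall l c τ) with hSdef
  have hs' : (0 : ℝ) < s := by exact_mod_cast hs
  -- The extra bin is paid for by `s ≤ |V|`, so `K ≥ 2` covers both the number and the size of the
  -- bins.
  refine ⟨Finset.filter_subset _ _, hS, V.card / s + 1,
    fun j => (V \ S).filter (fun v => binIndex V f s v = j), ?_, ?_, ?_, ?_, ?_⟩
  · have h1 : ((V.card / s : ℕ) : ℝ) ≤ (V.card : ℝ) / s := Nat.cast_div_le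
    have h2 : (1 : ℝ) ≤ (V.card : ℝ) / s := by
      rw [one_le_div hs']; exact_mod_cast hsn
    push_cast
    nlinarith
  · intro i j hij
    rw [Finset.disjoint_left]
    intro v hi hj
    exact hij (Fin.ext ((Finset.mem_filter.1 hi).2.symm.trans (Finset.mem_filter.1 hj).2))
  · intro v
    constructor
    · intro hv
      exact ⟨⟨binIndex V f s v, binIndex_lt f s⟩, Finset.mem_filter.2 ⟨hv, rfl⟩⟩
    · rintro ⟨i, hi⟩
      exact (Finset.mem_filter.1 hi).1
  · intro i
    have h1 : ((V \ S).filter (fun v => binIndex V f s v = i)).card ≤ 2 * s := by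
      refine (Finset.card_le_card
        (Finset.filter_subset_filter _ Finset.sdiff_subset)).trans (card_bin_le V f hs ?_ i)
      intro q
      rcases (V.filter (fun u => f u = q)).eq_empty_or_nonempty with h0 | ⟨x, hx⟩
      · rw [h0]; simp
      · refine (Finset.card_le_card ?_).trans
          ((card_gridCell_le V hl τ (gridCell l τ x)).trans hls)
        intro u hu
        rw [Finset.mem_filter] at hu hx ⊢
        exact ⟨hu.1, Encodable.encode_injective (hu.2.trans hx.2.symm)⟩
    have h2 : (((V \ S).filter (fun v => binIndex V f s v = i)).card : ℝ) ≤ 2 * s := by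
      exact_mod_cast h1
    exact h2.trans (mul_le_mul_of_nonneg_right hK hs'.le)
  · intro i j hij u v hu hv hadj
    rw [Finset.mem_filter, Finset.mem_sdiff, hSdef, Finset.mem_filter] at hu hv
    have hu' : ¬ InWall l c τ u.1 := fun h => hu.1.2 ⟨hu.1.1, h⟩
    have hv' : ¬ InWall l c τ v.1 := fun h => hv.1.2 ⟨hv.1.1, h⟩
    have hcell := gridCell_eq_of_dist_le hl hu' hv' (hG u v hadj).2
    have hb : binIndex V f s u.1 = binIndex V f s v.1 :=
      binIndex_congr V f s (by simp only [hf, hcell])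
    exact hij (Fin.ext (hu.2.symm.trans (hb.trans hv.2)))

/-- A graph with few nodes is separated by the empty set. -/
theorem isPseudoSeparator_empty (G : ImplicitGraph d k) {c s : ℕ} {K : ℝ} (hs : 0 < s)
    (hsn : s ≤ G.nodes.card) (hK : (G.nodes.card : ℝ) ≤ K) :
    G.IsPseudoSeparator c s K ∅ := by
  have hs1 : (1 : ℝ) ≤ s := by exact_mod_cast hs
  have hn : (s : ℝ) ≤ G.nodes.card := by exact_mod_cast hsn
  have hK1 : 1 ≤ K := by linarith
  refine ⟨Finset.empty_subset _, ?_, 1, fun _ => G.nodes, ?_, ?_, ?_, ?_, ?_⟩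
  · have := Real.log_nonneg hs1
    simp only [Finset.card_empty, Nat.cast_zero]
    positivity
  · have h2 : (1 : ℝ) ≤ (G.nodes.card : ℝ) / s := by
      rw [one_le_div (by linarith)]; exact hn
    push_cast
    nlinarith
  · exact fun i j hij => absurd (Subsingleton.elim i j) hij
  · intro v
    simp
  · intro i
    nlinarith
  · exact fun i j hij => absurd (Subsingleton.elim i j) hij

end ImplicitGraph

/-! ### A converge-cast and a broadcast -/

/-- The points of a flat list of node records, each of `d + k` words (at most `q` of them). -/
def decodePoints (d k : ℕ) : ℕ → List ℕ → List (Fin d → ℕ)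
  | 0, _ => []
  | q + 1, l =>
    if l = [] then [] else (fun a => l.getD a 0) :: decodePoints d k q (l.drop (d + k))

theorem decodePoints_flatMap {d k : ℕ} (hd : 0 < d) (g : (Fin d → ℕ) → Fin k → ℕ)
    (L : List (Fin d → ℕ)) (q : ℕ) (hq : L.length ≤ q) :
    decodePoints d k q (L.flatMap fun v => List.ofFn v ++ List.ofFn (g v)) = L := by
  induction L generalizing q with
  | nil => cases q <;> simp [decodePoints]
  | cons v L ih =>
    obtain _ | q := q
    · simp at hq
    have hne : (List.ofFn v ++ List.ofFn (g v)) ++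
        L.flatMap (fun v => List.ofFn v ++ List.ofFn (g v)) ≠ [] := by
      intro h
      have := congrArg List.length h
      simp at this
      omega
    rw [List.flatMap_cons, decodePoints, if_neg hne, List.drop_left' (by simp),
      ih q (by simpa using hq)]
    congr 1
    funext a
    rw [List.append_assoc, List.getD_append _ _ _ _ (by simp), List.getD_eq_getElem _ _ (by simp)]
    simp

/-- The least minimizer of `g` below `l`. -/
noncomputable def argminBelow (l : ℕ) (g : ℕ → ℕ) : ℕ :=
  sInf {τ | τ < l ∧ ∀ τ' < l, g τ ≤ g τ'}

theorem argminBelow_spec {l : ℕ} (hl : 0 < l) (g : ℕ → ℕ) :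
    argminBelow l g < l ∧ ∀ τ' < l, g (argminBelow l g) ≤ g τ' := by
  obtain ⟨τ, h1, h2⟩ := Finset.exists_min_image (Finset.range l) g ⟨0, Finset.mem_range.2 hl⟩
  exact Nat.sInf_mem (s := {τ | τ < l ∧ ∀ τ' < l, g τ ≤ g τ'})
    ⟨τ, Finset.mem_range.1 h1, fun τ' h => h2 τ' (Finset.mem_range.2 h)⟩

/-- Received vectors have length `l`, so tallies agree with the true counts only below `l`; this is
enough. -/
theorem argminBelow_congr {l : ℕ} {g g' : ℕ → ℕ} (h : ∀ τ < l, g τ = g' τ) :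
    argminBelow l g = argminBelow l g' := by
  unfold argminBelow
  congr 1
  ext τ
  simp only [Set.mem_ofPred_eq]
  refine and_congr_right fun hτ => forall₂_congr fun τ' hτ' => ?_
  rw [h τ hτ, h τ' hτ']

/-- A cap on a summand matters only if the total is capped anyway. Thus capping at every tree node
amounts to capping once at the root. -/
theorem min_sum_min {ι : Type*} (B : ℕ) (A : Finset ι) (y : ι → ℕ) :
    min B (∑ i ∈ A, min B (y i)) = min B (∑ i ∈ A, y i) := by
  classical
  induction A using Finset.induction_on with
  | empty => simp
  | insert i A hi ih =>
    rw [Finset.sum_insert hi, Finset.sum_insert hi]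
    omega

/-- The number of `x`-values collected, up to the cap `B`, by machine `j` after `t` levels of a
converge-cast of fan-in `f`. -/
def collected {m : ℕ} (B f : ℕ) (x : Fin m → ℕ) (t j : ℕ) : ℕ :=
  min B (∑ i : Fin m, if (i : ℕ) / f ^ t = j then x i else 0)

/-- Each source `i'` reaches level `t + 1` through exactly one machine, `i' / f ^ t`, and a further
division by `f` gives `i' / f ^ (t + 1)`. -/
theorem collected_succ {m : ℕ} (B f : ℕ) (x : Fin m → ℕ) (t j : ℕ) :
    min B (∑ i : Fin m, if (i : ℕ) / f = j then collected B f x t i else 0) =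
      collected B f x (t + 1) j := by
  have h1 : ∀ i : Fin m, (if (i : ℕ) / f = j then collected B f x t i else 0) =
      min B (if (i : ℕ) / f = j then ∑ i' : Fin m, if (i' : ℕ) / f ^ t = i then x i' else 0
        else 0) := by
    intro i
    split_ifs
    · rfl
    · simp
  simp only [h1]
  rw [min_sum_min, collected]
  congr 1
  have h2 : ∀ i : Fin m, (if (i : ℕ) / f = j then
        ∑ i' : Fin m, if (i' : ℕ) / f ^ t = i then x i' else 0 else 0) =
      ∑ i' : Fin m, if (i' : ℕ) / f ^ t = i then (if (i : ℕ) / f = j then x i' else 0) else 0 := by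
    intro i
    split_ifs <;> simp
  simp only [h2]
  rw [Finset.sum_comm]
  refine Finset.sum_congr rfl fun i' _ => ?_
  have hlt : (i' : ℕ) / f ^ t < m := (Nat.div_le_self _ _).trans_lt i'.2
  rw [Finset.sum_eq_single (⟨(i' : ℕ) / f ^ t, hlt⟩ : Fin m)]
  · simp [Nat.div_div_eq_div_mul, pow_succ]
  · intro b _ hb
    rw [if_neg]
    intro h
    exact hb (Fin.ext h.symm)
  · simp

theorem collected_zero {m : ℕ} (B f : ℕ) (x : Fin m → ℕ) (i : Fin m) :
    collected B f x 0 i = min B (x i) := by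
  simp [collected, Fin.val_inj]

theorem collected_root {m : ℕ} (B f : ℕ) (x : Fin m → ℕ) {T : ℕ} (hT : m ≤ f ^ T) :
    collected B f x T 0 = min B (∑ i, x i) := by
  unfold collected
  congr 1
  refine Finset.sum_congr rfl fun i _ => ?_
  rw [if_pos (Nat.div_eq_of_lt (i.2.trans_le hT))]

theorem MPCAlgorithm.run_succ {m mem w : ℕ} (A : MPCAlgorithm m mem w) (x : Fin m → List ℕ)
    (R : ℕ) (ω : MPCTape m mem w (R + 1)) (i : Fin m) :
    A.run x (R + 1) ω i =
      A.step R i (A.run x R (fun t => ω t.castSucc) i).1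
        (fun j => (A.run x R (fun t => ω t.castSucc) j).2 i) (ω (Fin.last R) i) :=
  rfl

/-! ### The shift search and its configurations round by round -/

section ShiftSearch

variable {d m mem w : ℕ}

/-- For each `τ`, the number (capped) of points with `P τ` that a machine knows of. -/
def tally (k : ℕ) (P : ℕ → (Fin d → ℕ) → Bool) (t : ℕ) (M : List ℕ) (inbox : Fin m → List ℕ)
    (B τ : ℕ) : ℕ :=
  min B (if t = 0 then (decodePoints d k M.length M).countP (P τ)
    else ∑ j, (inbox j).getD τ 0)

/-- The value `τ < l` that a machine regards as the best one. -/
noncomputable def chosenShift (k : ℕ) (P : ℕ → (Fin d → ℕ) → Bool) (l T t : ℕ) (M : List ℕ)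
    (inbox : Fin m → List ℕ) (B : ℕ) : ℕ :=
  -- In round `T` every machine takes an argmin, but only the root has all the counts; the broadcast
  -- overwrites the other choices. Later inboxes hold a single word, so the sum reads it off.
  if t = T then argminBelow l (tally k P t M inbox B) else ∑ j, (inbox j).sum

/-- The algorithm that finds `τ < l` such that `P τ` holds for the fewest points, and outputs
these points: the numbers of points are summed along a tree of degree `f` and depth `T`, and
the root broadcasts the best `τ` along the same tree. -/
noncomputable def shiftSearch (k : ℕ) (P : ℕ → (Fin d → ℕ) → Bool) (l f T : ℕ) :
    MPCAlgorithm m mem w where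
  step t i M inbox _ :=
    if t < T then
      (M, fun j => if (j : ℕ) = i / f then (List.range l).map (tally k P t M inbox (2 ^ w - 1))
        else [])
    else if t < 2 * T then
      (M, fun j => if (j : ℕ) / f = i then [chosenShift k P l T t M inbox (2 ^ w - 1)] else [])
    else
      (1 :: ((decodePoints d k M.length M).filter
        (P (chosenShift k P l T t M inbox (2 ^ w - 1)))).flatMap (fun v => List.ofFn v),
        fun _ => [])

variable {k : ℕ} (G : ImplicitGraph d k) (P : ℕ → (Fin d → ℕ) → Bool) (l f T : ℕ)
  (load : Fin m → List (Fin d → ℕ))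

/-- The numbers of points with `P τ` that machine `j` knows of after `t` rounds. -/
def knownCount (w t j τ : ℕ) : ℕ :=
  collected (2 ^ w - 1) f (fun i => (load i).countP (P τ)) t j

/-- The value `τ` that machine `i` knows after `u` rounds of broadcasting. -/
noncomputable def knownShift (w u i : ℕ) : ℕ :=
  argminBelow l (knownCount P f load w T (i / f ^ u))

theorem decodePoints_load (hd : 0 < d) (i : Fin m) :
    decodePoints d k ((load i).flatMap G.encodeNode).length ((load i).flatMap G.encodeNode) =
      load i := by
  refine decodePoints_flatMap hd G.info (load i) _ ?_
  rw [List.length_flatMap]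
  simp only [ImplicitGraph.encodeNode, List.length_append, List.length_ofFn, List.map_const',
    List.sum_replicate, smul_eq_mul]
  -- The recursion bound is the number of words, which is at least the number of records as `0 < d`.
  exact Nat.le_mul_of_pos_right _ (by omega)

theorem tally_inbox (t : ℕ) (i : Fin m) (M : List ℕ) {τ : ℕ} (hτ : τ < l) :
    tally k P (t + 1) M (fun j : Fin m => if (i : ℕ) = j / f then
      (List.range l).map (knownCount P f load w t j) else []) (2 ^ w - 1) τ =
      knownCount P f load w (t + 1) i τ := by
  rw [tally, if_neg (by omega), knownCount, ← collected_succ]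
  congr 1
  refine Finset.sum_congr rfl fun a _ => ?_
  by_cases h : (i : ℕ) = a / f
  · rw [if_pos h, if_pos h.symm, List.getD_eq_getElem _ _ (by simpa using hτ)]
    simp [knownCount]
  · rw [if_neg h, if_neg (Ne.symm h)]
    simp

/-- The configuration while the counts are being summed. -/
theorem shiftSearch_run_up (hd : 0 < d) (t : ℕ) (ht : t < T) (ω : MPCTape m mem w (t + 1))
    (i : Fin m) :
    (shiftSearch k P l f T).run (fun i => (load i).flatMap G.encodeNode) (t + 1) ω i =
      ((load i).flatMap G.encodeNode, fun j : Fin m => if (j : ℕ) = i / f then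
        (List.range l).map (knownCount P f load w t i) else []) := by
  induction t generalizing i with
  | zero =>
    simp only [MPCAlgorithm.run, shiftSearch, if_pos ht]
    congr 1
    funext j
    congr 1
    refine List.map_congr_left fun τ _ => ?_
    rw [tally, if_pos rfl, decodePoints_load G load hd, knownCount, collected_zero]
  | succ t ih =>
    rw [MPCAlgorithm.run_succ]
    simp only [ih (by omega)]
    simp only [shiftSearch, if_pos ht]
    congr 1
    funext j
    congr 1
    refine List.map_congr_left fun τ hτ => ?_
    exact tally_inbox P l f load t i _ (List.mem_range.1 hτ)

theorem tally_root (hd : 0 < d) (hT : 0 < T) (ω : MPCTape m mem w T) (i : Fin m)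
    {τ : ℕ} (hτ : τ < l) (M : List ℕ) :
    tally k P T M (fun j => (((shiftSearch k P l f T).run
      (fun i => (load i).flatMap G.encodeNode) T ω) j).2 i) (2 ^ w - 1) τ =
      knownCount P f load w T i τ := by
  obtain ⟨t, rfl⟩ : ∃ t, T = t + 1 := ⟨T - 1, by omega⟩
  simp only [shiftSearch_run_up G P l f (t + 1) load hd t (Nat.lt_succ_self t)]
  exact tally_inbox P l f load t i M hτ

/-- The choice that a machine makes in each round of the broadcast. -/
theorem sum_inbox_broadcast (u : ℕ) (i : Fin m) :
    ∑ j : Fin m, (if (i : ℕ) / f = j then [knownShift P l f T load w u j] else []).sum =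
      knownShift P l f T load w (u + 1) i := by
  have hlt : (i : ℕ) / f < m := (Nat.div_le_self _ _).trans_lt i.2
  rw [Finset.sum_eq_single (⟨(i : ℕ) / f, hlt⟩ : Fin m)]
  · simp [knownShift, Nat.div_div_eq_div_mul, pow_succ']
  · intro b _ hb
    rw [if_neg]
    · rfl
    · exact fun h => hb (Fin.ext h.symm)
  · simp

/-- The configuration while the result is being broadcast. -/
theorem shiftSearch_run_down (hd : 0 < d) (hT : 0 < T) (u : ℕ) (hu : u < T)
    (ω : MPCTape m mem w (T + u + 1)) (i : Fin m) :
    (shiftSearch k P l f T).run (fun i => (load i).flatMap G.encodeNode) (T + u + 1) ω i =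
      ((load i).flatMap G.encodeNode, fun j : Fin m => if (j : ℕ) / f = i then
        [knownShift P l f T load w u i] else []) := by
  induction u generalizing i with
  | zero =>
    rw [MPCAlgorithm.run_succ]
    have hmem : ∀ (ω : MPCTape m mem w T) (i : Fin m), ((shiftSearch k P l f T).run
        (fun i => (load i).flatMap G.encodeNode) T ω i).1 = (load i).flatMap G.encodeNode := by
      obtain ⟨t, rfl⟩ : ∃ t, T = t + 1 := ⟨T - 1, by omega⟩
      intro ω i
      rw [shiftSearch_run_up G P l f (t + 1) load hd t (Nat.lt_succ_self t)]
    conv_lhs => rw [shiftSearch]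
    simp only [lt_irrefl, if_false]
    rw [if_pos (by omega)]
    refine Prod.ext (hmem _ i) ?_
    funext j
    dsimp only
    congr 2
    rw [chosenShift, if_pos rfl, knownShift, pow_zero, Nat.div_one]
    exact argminBelow_congr fun τ hτ => tally_root G P l f T load hd hT _ i hτ _
  | succ u ih =>
    have hrun : ∀ (ω : MPCTape m mem w (T + (u + 1))) (i : Fin m), (shiftSearch k P l f T).run
        (fun i => (load i).flatMap G.encodeNode) (T + (u + 1)) ω i =
        ((load i).flatMap G.encodeNode, fun j : Fin m => if (j : ℕ) / f = i then
          [knownShift P l f T load w u i] else []) := ih (by omega)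
    rw [MPCAlgorithm.run_succ]
    simp only [hrun]
    conv_lhs => rw [shiftSearch]
    dsimp only
    rw [if_neg (by omega), if_pos (by omega)]
    refine Prod.ext rfl ?_
    funext j
    dsimp only
    congr 2
    rw [chosenShift, if_neg (by omega), sum_inbox_broadcast]

/-- The final configuration. -/
theorem shiftSearch_run_last (hd : 0 < d) (hT : 0 < T) (ω : MPCTape m mem w (2 * T + 1))
    (i : Fin m) :
    (shiftSearch k P l f T).run (fun i => (load i).flatMap G.encodeNode) (2 * T + 1) ω i =
      (1 :: ((load i).filter (P (knownShift P l f T load w T i))).flatMap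
        (fun v => List.ofFn v), fun _ => []) := by
  obtain ⟨t, rfl⟩ : ∃ t, T = t + 1 := ⟨T - 1, by omega⟩
  have h2 : 2 * (t + 1) = t + 1 + t + 1 := by ring
  rw [MPCAlgorithm.run_succ]
  -- The tape's type mentions the number of rounds; an arbitrary tape allows that number to be
  -- rewritten.
  generalize hω : (fun r : Fin (2 * (t + 1)) => ω r.castSucc) = ω'
  clear hω
  have hrun : ∀ j, (shiftSearch k P l f (t + 1)).run (fun i => (load i).flatMap G.encodeNode)
      (2 * (t + 1)) ω' j =
      ((load j).flatMap G.encodeNode, fun a : Fin m => if (a : ℕ) / f = j then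
        [knownShift P l f (t + 1) load w t j] else []) := by
    revert ω'
    rw [h2]
    exact fun ω' j => shiftSearch_run_down G P l f (t + 1) load hd hT t (Nat.lt_succ_self t) ω' j
  simp only [hrun]
  conv_lhs => rw [shiftSearch]
  dsimp only
  rw [if_neg (by omega), if_neg (by omega), chosenShift, if_neg (by omega), sum_inbox_broadcast,
    decodePoints_load G load hd]

end ShiftSearch

/-! ### Resources and output -/

theorem sum_length_ite_le {m b L mem : ℕ} (r : Fin m → Prop) [DecidablePred r]
    (msg : Fin m → List ℕ) (hb : (Finset.univ.filter r).card ≤ b) (hL : ∀ j, (msg j).length ≤ L)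
    (h : b * L ≤ mem) : ∑ j, (if r j then msg j else []).length ≤ mem := by
  have h1 : ∀ j, (if r j then msg j else []).length = if r j then (msg j).length else 0 := by
    intro j
    split_ifs <;> rfl
  simp only [h1]
  rw [← Finset.sum_filter]
  refine (Finset.sum_le_card_nsmul _ _ L fun j _ => hL j).trans ?_
  rw [smul_eq_mul]
  exact (Nat.mul_le_mul_right L hb).trans h

/-- Limits for a round in which machine `i` sends one and the same message to all `j` with
`r i j`. -/
theorem withinLimits_of_degrees {m mem w : ℕ} {σ : MPCConfig m} (r : Fin m → Fin m → Prop)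
    [∀ i, DecidablePred (r i)] (x msg : Fin m → List ℕ) {p q L : ℕ}
    (hσ : ∀ i, σ i = (x i, fun j => if r i j then msg i else []))
    (hx : ∀ i, FitsMemory mem w (x i)) (hL : ∀ i, (msg i).length ≤ L)
    (hmsg : ∀ i, ∀ y ∈ msg i, y < 2 ^ w)
    (hout : ∀ i, (Finset.univ.filter (r i)).card ≤ p)
    (hin : ∀ i, (Finset.univ.filter (fun j => r j i)).card ≤ q)
    (hLm : L ≤ mem) (hp : p * L ≤ mem) (hq : q * L ≤ mem) : σ.WithinLimits mem w := by
  intro i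
  simp only [hσ]
  refine ⟨hx i, fun j => ?_, ?_, ?_⟩
  · split_ifs
    · exact ⟨(hL i).trans hLm, hmsg i⟩
    · exact ⟨Nat.zero_le _, by simp⟩
  · exact sum_length_ite_le (r i) (fun _ => msg i) (hout i) (fun _ => hL i) hp
  · exact sum_length_ite_le (fun j => r j i) msg (hin i) hL hq

theorem card_children_le {m f : ℕ} (hf : 0 < f) (i : ℕ) :
    (Finset.univ.filter (fun j : Fin m => (j : ℕ) / f = i)).card ≤ f := by
  conv_rhs => rw [← Finset.card_range f]
  refine Finset.card_le_card_of_injOn (fun j => (j : ℕ) % f) ?_ ?_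
  · intro j _
    simpa using Nat.mod_lt _ hf
  · intro j hj j' hj' h
    simp only [Finset.coe_filter, Finset.mem_univ, true_and, Set.mem_ofPred_eq] at hj hj'
    have h1 := Nat.div_add_mod (j : ℕ) f
    have h2 := Nat.div_add_mod (j' : ℕ) f
    have h3 : (j : ℕ) % f = j' % f := h
    rw [hj] at h1
    rw [hj'] at h2
    exact Fin.ext (by omega)

theorem card_parent_le {m : ℕ} (i : ℕ) :
    (Finset.univ.filter (fun j : Fin m => (j : ℕ) = i)).card ≤ 1 :=
  Finset.card_le_one.2 fun _ ha _ hb =>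
    Fin.ext ((Finset.mem_filter.1 ha).2.trans (Finset.mem_filter.1 hb).2.symm)

/-- A placement partitions `V` without repetition, so the value at the root is a true count of
nodes. -/
theorem sum_countP_load {d m : ℕ} {V : Finset (Fin d → ℕ)} {s : ℕ}
    {load : Fin m → List (Fin d → ℕ)} (h : IsPlacement V s load) (p : (Fin d → ℕ) → Bool) :
    ∑ i, (load i).countP p = (V.filter (fun v => p v = true)).card := by
  classical
  have h1 : V.filter (fun v => p v = true) =
      Finset.univ.biUnion (fun i => ((load i).filter p).toFinset) := by
    ext v
    simp only [Finset.mem_filter, Finset.mem_biUnion, Finset.mem_univ, true_and,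
      List.mem_toFinset, List.mem_filter, h.2.1 v]
    tauto
  rw [h1, Finset.card_biUnion]
  · refine Finset.sum_congr rfl fun i _ => ?_
    rw [List.toFinset_card_of_nodup ((h.1 i).2.filter _), List.countP_eq_length_filter]
  · intro i _ j _ hij
    refine Finset.disjoint_left.2 fun v hi hj => ?_
    simp only [List.mem_toFinset, List.mem_filter] at hi hj
    exact hij (h.2.2 i j v hi.1 hj.1)

theorem length_flatMap_of_const {β γ : Type*} (L : List β) (g : β → List γ) {r : ℕ}
    (hg : ∀ v, (g v).length = r) : (L.flatMap g).length = L.length * r := by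
  rw [List.length_flatMap]
  simp [hg]

/-! ### Limits and output of the shift search -/

section ShiftSearch

variable {d k m mem w : ℕ} (G : ImplicitGraph d k) (P : ℕ → (Fin d → ℕ) → Bool) (l f T : ℕ)
  (load : Fin m → List (Fin d → ℕ))

/-- The heaviest traffic is on the way up, when a machine receives `l` counts from each of at most
`f` children; on the way down it sends one word to each child. -/
theorem shiftSearch_withinLimits {s : ℕ} (hd : 0 < d) (hT : 0 < T) (hl : 0 < l) (hf : 0 < f)
    (hG : G.FitsWords w) (hload : IsPlacement G.nodes s load) (hw : 1 < 2 ^ w) (hlw : l ≤ 2 ^ w)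
    (hin : s * (d + k) ≤ mem) (hout : s * d + 1 ≤ mem) (hfl : f * l ≤ mem) (t : ℕ)
    (ht : t ≤ 2 * T + 1) (ω : MPCTape m mem w t) :
    ((shiftSearch k P l f T).run (fun i => (load i).flatMap G.encodeNode) t ω).WithinLimits
      mem w := by
  have hlen : ∀ i, (load i).length ≤ s := fun i => (hload.1 i).1
  have hnode : ∀ i, ∀ v ∈ load i, v ∈ G.nodes := fun i v hv => (hload.2.1 v).2 ⟨i, hv⟩
  have hx : ∀ i, FitsMemory mem w ((load i).flatMap G.encodeNode) := by
    intro i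
    constructor
    · rw [length_flatMap_of_const _ _ (r := d + k) (by simp [ImplicitGraph.encodeNode])]
      exact (Nat.mul_le_mul_right _ (hlen i)).trans hin
    · intro y hy
      obtain ⟨v, hv, hy⟩ := List.mem_flatMap.1 hy
      rw [ImplicitGraph.encodeNode, List.mem_append, List.mem_ofFn, List.mem_ofFn] at hy
      obtain ⟨a, rfl⟩ | ⟨a, rfl⟩ := hy
      · exact (hG v (hnode i v hv)).1 a
      · exact (hG v (hnode i v hv)).2 a
  have hlm : l ≤ mem := (Nat.le_mul_of_pos_left l hf).trans hfl
  have hfm : f * 1 ≤ mem := (Nat.mul_le_mul_left f hl).trans hfl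
  obtain _ | t := t
  · exact withinLimits_of_degrees (fun _ _ => False) (fun i => (load i).flatMap G.encodeNode)
      (fun _ => []) (p := 0) (q := 0) (L := 0) (fun i => by simp [MPCAlgorithm.run]) hx (by simp)
      (by simp) (by simp) (by simp) (by simp) (by simp) (by simp)
  rcases lt_or_ge t T with h1 | h1
  · refine withinLimits_of_degrees (fun i j => (j : ℕ) = i / f)
      (fun i => (load i).flatMap G.encodeNode)
      (fun i => (List.range l).map (knownCount P f load w t i)) (p := 1) (q := f) (L := l)
      (shiftSearch_run_up G P l f T load hd t h1 ω) hx (by simp) ?_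
      (fun i => card_parent_le _) ?_ hlm (by simpa using hlm) hfl
    · intro i y hy
      obtain ⟨τ, -, rfl⟩ := List.mem_map.1 hy
      have : knownCount P f load w t i τ ≤ 2 ^ w - 1 := min_le_left _ _
      omega
    · intro i
      simp only [eq_comm (a := (i : ℕ))]
      exact card_children_le hf i
  rcases lt_or_ge t (2 * T) with h2 | h2
  · obtain ⟨u, rfl⟩ := Nat.exists_eq_add_of_le h1
    refine withinLimits_of_degrees (fun i j => (j : ℕ) / f = i)
      (fun i => (load i).flatMap G.encodeNode)
      (fun i => [knownShift P l f T load w u i]) (p := f) (q := 1) (L := 1)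
      (shiftSearch_run_down G P l f T load hd hT u (by omega) ω) hx (by simp) ?_
      (fun i => card_children_le hf i) ?_ (by omega) hfm (by omega)
    · intro i y hy
      rw [List.mem_singleton] at hy
      rw [hy]
      exact (argminBelow_spec hl _).1.trans_le hlw
    · intro i
      simp only [eq_comm (a := (i : ℕ) / f)]
      exact card_parent_le _
  · obtain rfl : t = 2 * T := by omega
    refine withinLimits_of_degrees (fun _ _ => False)
      (fun i => 1 :: ((load i).filter (P (knownShift P l f T load w T i))).flatMap
        (fun v => List.ofFn v)) (fun _ => []) (p := 0) (q := 0) (L := 0)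
      (fun i => by rw [shiftSearch_run_last G P l f T load hd hT]; simp) ?_ (by simp)
      (by simp) (by simp) (by simp) (by simp) (by simp) (by simp)
    intro i
    constructor
    · rw [List.length_cons, length_flatMap_of_const _ _ (r := d) (by simp)]
      have h3 := Nat.mul_le_mul_right d
        ((List.length_filter_le (P (knownShift P l f T load w T i)) (load i)).trans (hlen i))
      omega
    · intro y hy
      rw [List.mem_cons, List.mem_flatMap] at hy
      obtain rfl | ⟨v, hv, hy⟩ := hy
      · exact hw
      · obtain ⟨a, rfl⟩ := (List.mem_ofFn' _ _).1 hy
        exact (hG v (hnode i v (List.mem_filter.1 hv).1)).1 a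

/-- Some `τ < l` minimizes, up to the cap `2 ^ w - 1`, the number of nodes with `P τ`, and the
algorithm outputs these nodes. -/
theorem shiftSearch_outputs {s : ℕ} (hd : 0 < d) (hT : 0 < T) (hl : 0 < l)
    (hload : IsPlacement G.nodes s load) (hm : m ≤ f ^ T) :
    ∃ τ < l, (∀ τ' < l, min (2 ^ w - 1) (G.nodes.filter (fun v => P τ v = true)).card ≤
        min (2 ^ w - 1) (G.nodes.filter (fun v => P τ' v = true)).card) ∧
      ∀ ω : MPCTape m mem w (2 * T + 1),
        ((shiftSearch k P l f T).run (fun i => (load i).flatMap G.encodeNode) (2 * T + 1)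
          ω).Outputs (G.nodes.filter (fun v => P τ v = true)) := by
  obtain ⟨h1, h2⟩ := argminBelow_spec hl (knownCount P f load w T 0)
  refine ⟨_, h1, ?_, fun ω => ⟨fun i => (load i).filter (P (knownShift P l f T load w T i)),
    fun i => by rw [shiftSearch_run_last G P l f T load hd hT], ?_⟩⟩
  · intro τ' hτ'
    have h3 := h2 τ' hτ'
    rwa [knownCount, knownCount, collected_root _ _ _ hm, collected_root _ _ _ hm,
      sum_countP_load hload, sum_countP_load hload] at h3
  · intro v
    have h3 : ∀ i : Fin m, knownShift P l f T load w T i =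
        argminBelow l (knownCount P f load w T 0) := by
      intro i
      rw [knownShift, Nat.div_eq_of_lt (i.2.trans_le hm)]
    simp only [h3, Finset.mem_filter, List.mem_filter, hload.2.1 v]
    tauto

end ShiftSearch

/-- An algorithm that succeeds on every random tape is Las Vegas. -/
theorem lasVegas_of_forall {d k m mem w : ℕ} {A : MPCAlgorithm m mem w} {R : ℕ}
    {G : ImplicitGraph d k} {c s : ℕ} {K δ : ℝ} (hδ : 0 ≤ δ)
    (hlim : ∀ load : Fin m → List (Fin d → ℕ), IsPlacement G.nodes s load → ∀ t ≤ R,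
      ∀ ω : MPCTape m mem w t,
        (A.run (fun i => (load i).flatMap G.encodeNode) t ω).WithinLimits mem w)
    (hout : ∀ load : Fin m → List (Fin d → ℕ), IsPlacement G.nodes s load →
      ∀ ω : MPCTape m mem w R, ∃ S,
        (A.run (fun i => (load i).flatMap G.encodeNode) R ω).Outputs S ∧
          G.IsPseudoSeparator c s K S) :
    LasVegasComputesSeparator A R G c s K δ := by
  intro load hload
  refine ⟨hlim load hload, fun ω => Or.inr (hout load hload ω), ?_⟩
  have h : MPCTape.prob (fun ω : MPCTape m mem w R => ∃ S,
      (A.run (fun i => (load i).flatMap G.encodeNode) R ω).Outputs S ∧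
        G.IsPseudoSeparator c s K S) = 1 := by
    rw [MPCTape.prob, Nat.card_congr (Equiv.subtypeUnivEquiv (hout load hload))]
    exact div_self (Nat.cast_ne_zero.2 Nat.card_pos.ne')
  rw [h]
  linarith

/-! ### Parameters -/

/-- The mesh of the grid whose cells hold at most `s` lattice points. -/
noncomputable def meshSize (d s : ℕ) : ℕ := ⌊(s : ℝ) ^ ((1 : ℝ) / (d : ℝ))⌋₊

theorem meshSize_pow_le {d : ℕ} (hd : 0 < d) (s : ℕ) : meshSize d s ^ d ≤ s := by
  have h0 : (0 : ℝ) ≤ (s : ℝ) ^ ((1 : ℝ) / (d : ℝ)) := by positivity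
  have h1 : ((meshSize d s : ℕ) : ℝ) ^ d ≤ ((s : ℝ) ^ ((1 : ℝ) / (d : ℝ))) ^ d :=
    pow_le_pow_left₀ (Nat.cast_nonneg _) (Nat.floor_le h0) d
  rw [one_div, Real.rpow_inv_natCast_pow (Nat.cast_nonneg s) hd.ne'] at h1
  exact_mod_cast h1

theorem one_le_rpow_mesh (d : ℕ) {s : ℕ} (hs : 0 < s) :
    (1 : ℝ) ≤ (s : ℝ) ^ ((1 : ℝ) / (d : ℝ)) :=
  Real.one_le_rpow (by exact_mod_cast hs) (by positivity)

theorem meshSize_pos (d : ℕ) {s : ℕ} (hs : 0 < s) : 0 < meshSize d s :=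
  Nat.floor_pos.2 (one_le_rpow_mesh d hs)

theorem rpow_le_two_mul_meshSize (d : ℕ) {s : ℕ} (hs : 0 < s) :
    (s : ℝ) ^ ((1 : ℝ) / (d : ℝ)) ≤ 2 * meshSize d s := by
  have h1 : (s : ℝ) ^ ((1 : ℝ) / (d : ℝ)) < meshSize d s + 1 := Nat.lt_floor_add_one _
  have h2 : (1 : ℝ) ≤ meshSize d s := by exact_mod_cast meshSize_pos d hs
  linarith

/-- This lets trees of degree about `√s` carry vectors of `l` counts within `O(s)` words. -/
theorem meshSize_le_sqrt {d : ℕ} (hd : 2 ≤ d) {s : ℕ} (hs : 0 < s) :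
    meshSize d s ≤ Nat.sqrt s := by
  rw [Nat.le_sqrt']
  exact (Nat.pow_le_pow_right (meshSize_pos d hs) hd).trans (meshSize_pow_le (by omega) s)

/-- Trees of degree about `√s` and of constant depth reach all machines. -/
theorem le_sqrt_succ_pow {α a : ℝ} (hα : 0 < α) (ha : 0 < a) {p : ℕ} (hp : 1 / a ≤ 2 ^ p)
    {n s : ℕ} (hs : 0 < s) (h : a * (n : ℝ) ^ α ≤ s) :
    n ≤ (Nat.sqrt s + 1) ^ ⌈((2 + p : ℕ) : ℝ) / α⌉₊ := by
  set f := Nat.sqrt s + 1 with hf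
  have hf2 : 2 ≤ f := by
    have : 0 < Nat.sqrt s := Nat.sqrt_pos.2 hs
    omega
  have hf2' : (2 : ℝ) ≤ f := by exact_mod_cast hf2
  have hsf : (s : ℝ) ≤ (f : ℝ) ^ 2 := by
    have := (Nat.lt_succ_sqrt' s).le
    exact_mod_cast this
  -- As `f ≥ 2`, the constant `1 / a ≤ 2 ^ p` is absorbed into `f ^ p`.
  have h1 : (n : ℝ) ^ α ≤ (f : ℝ) ^ (2 + p) := by
    calc (n : ℝ) ^ α ≤ s * (1 / a) := by
          rw [mul_one_div, le_div_iff₀ ha, mul_comm]; exact h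
      _ ≤ (f : ℝ) ^ 2 * (f : ℝ) ^ p :=
          mul_le_mul hsf (hp.trans (pow_le_pow_left₀ (by norm_num) hf2' p)) (by positivity)
            (by positivity)
      _ = (f : ℝ) ^ (2 + p) := (pow_add _ _ _).symm
  have h2 : (n : ℝ) ≤ (f : ℝ) ^ (((2 + p : ℕ) : ℝ) / α) := by
    have h3 := Real.rpow_le_rpow (by positivity) h1 (inv_pos.2 hα).le
    rw [Real.rpow_rpow_inv (Nat.cast_nonneg n) hα.ne', ← Real.rpow_natCast, ← Real.rpow_mul
      (by positivity)] at h3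
    rwa [div_eq_mul_inv]
  have h4 : (f : ℝ) ^ (((2 + p : ℕ) : ℝ) / α) ≤ (f : ℝ) ^ ((⌈((2 + p : ℕ) : ℝ) / α⌉₊ : ℕ) : ℝ) :=
    Real.rpow_le_rpow_of_exponent_le (by linarith) (Nat.le_ceil _)
  rw [Real.rpow_natCast] at h4
  exact_mod_cast h2.trans h4

theorem machineCount_le {n s : ℕ} (hs : 0 < s) : machineCount n s ≤ n := by
  rw [machineCount, ceilDiv_le_iff_le_mul hs]
  exact Nat.le_mul_of_pos_left n hs

/-- A shift that is best up to the cap `B` puts few points into walls. -/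
theorem card_walls_le {d c s N B : ℕ} (V : Finset (Fin d → ℕ)) (hs : 2 ≤ s)
    (hN : V.card = N) (hN2 : 2 ≤ N) (hB : N ≤ B + 1) {τ : ℕ} {K : ℝ} (hK : (8 : ℝ) * d ≤ K)
    (hτ : ∀ τ' < meshSize d s, min B (V.filter (InWall (meshSize d s) c τ)).card ≤
      min B (V.filter (InWall (meshSize d s) c τ')).card) :
    ((V.filter (InWall (meshSize d s) c τ)).card : ℝ) ≤
      K * (((c : ℝ) * (N : ℝ) / (s : ℝ) ^ ((1 : ℝ) / (d : ℝ))) * Real.log (s : ℝ)) := by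
  have hs0 : 0 < s := by omega
  obtain ⟨τ', hτ', hle⟩ := exists_shift_card_inWall_le V (meshSize_pos d hs0) c
  have h1 := hτ τ' hτ'
  set l := meshSize d s
  set S := (V.filter (InWall l c τ)).card
  set S' := (V.filter (InWall l c τ')).card
  have h2 : S ≤ N := by rw [← hN]; exact Finset.card_filter_le _ _
  -- The cap is felt only if `S = B + 1`; then `S' ≥ B ≥ 1`, hence `S ≤ 2 * S'`.
  have h3 : S ≤ 2 * S' := by omega
  have hr1 := one_le_rpow_mesh d hs0
  have hr2 : (s : ℝ) ^ ((1 : ℝ) / (d : ℝ)) ≤ 2 * l := rpow_le_two_mul_meshSize d hs0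
  set r := (s : ℝ) ^ ((1 : ℝ) / (d : ℝ))
  have h4 : (l : ℝ) * S' ≤ N * (d * c) := by
    rw [hN] at hle
    exact_mod_cast hle
  have h5 : (S : ℝ) ≤ 2 * S' := by exact_mod_cast h3
  -- One factor 2 comes from the cap, the other from rounding the mesh down.
  have h6 : (S : ℝ) ≤ 4 * d * (c * N / r) := by
    rw [mul_div_assoc', le_div_iff₀ (by linarith)]
    calc (S : ℝ) * r ≤ 2 * S' * (2 * l) :=
          mul_le_mul h5 hr2 (by linarith) (by positivity)
      _ = 4 * (l * S') := by ring
      _ ≤ 4 * (N * (d * c)) := by linarith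
      _ = 4 * d * (c * N) := by ring
  have hlog : (1 : ℝ) / 2 ≤ Real.log s := by
    have h7 : Real.log 2 ≤ Real.log s :=
      Real.log_le_log (by norm_num) (by exact_mod_cast hs)
    have := Real.log_two_gt_d9
    linarith
  have hX : (0 : ℝ) ≤ c * N / r := by positivity
  calc (S : ℝ) ≤ 4 * d * (c * N / r) := h6
    _ = 8 * d * (c * N / r * (1 / 2)) := by ring
    _ ≤ K * (c * N / r * Real.log s) :=
        mul_le_mul hK (mul_le_mul_of_nonneg_left hlog hX) (by positivity)
          ((by positivity : (0 : ℝ) ≤ 8 * d).trans hK)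

/-! ### Choice of constants and assembly -/

theorem mainTheorem6 (d k : ℕ) (hd : 3 ≤ d) (α a b : ℝ) (hα0 : 0 < α) (hα1 : α < 1)
    (ha : 0 < a) (hb : 0 < b) :
    ∃ (C R : ℕ) (K γ : ℝ), 0 < K ∧ 0 < γ ∧
      ∃ A : (n s c w : ℕ) → MPCAlgorithm (machineCount n s) (C * s) w,
        ∀ n s c w : ℕ,
          a * (n : ℝ) ^ α ≤ (s : ℝ) → (s : ℝ) ≤ b * (n : ℝ) ^ α → s < n →
          1 ≤ c → (c : ℝ) ≤ (s : ℝ) ^ ((1 : ℝ) / (d : ℝ) ^ 3) →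
          n ≤ 2 ^ w →
          ∀ G : ImplicitGraph d k, G.nodes.card = n → G.IsGridGraph c → G.FitsWords w →
            LasVegasComputesSeparator (A n s c w) R G c s K ((n : ℝ) ^ (-γ)) := by
  obtain ⟨p, hp⟩ := pow_unbounded_of_one_lt (1 / a) (one_lt_two (α := ℝ))
  set T := ⌈((2 + p : ℕ) : ℝ) / α⌉₊
  have hT : 0 < T := Nat.ceil_pos.2 (by positivity)
  have hd0 : 0 < d := by omega
  have hK0 : (0 : ℝ) ≤ (2 : ℝ) ^ T := by positivity
  have hd' : (3 : ℝ) ≤ d := by exact_mod_cast hd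
  -- The memory covers the records, the flagged output and the traffic of at most `2 * s` words. The
  -- rounds are `T` up, `T` down and one for output. In `K`, `8 * d` serves the walls and `2 ^ T`
  -- the case `s = 1`, where the test `1 < s` empties the output. Success is certain, so any
  -- positive exponent `γ` would do.
  refine ⟨d + k + 3, 2 * T + 1, 8 * d + 2 ^ T, 1, by positivity, one_pos,
    fun n s c _ => shiftSearch k (fun τ (v : Fin d → ℕ) => decide (1 < s ∧ InWall (meshSize d s) c τ v))
      (meshSize d s) (Nat.sqrt s + 1) T, ?_⟩
  intro n s c w has _ hsn _ _ hnw G hGn hGc hGw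
  have hs : 0 < s := by
    have hn : (0 : ℝ) < n := by exact_mod_cast (Nat.zero_le s).trans_lt hsn
    have : (0 : ℝ) < s := (by positivity : 0 < a * (n : ℝ) ^ α).trans_le has
    exact_mod_cast this
  have hpow := le_sqrt_succ_pow hα0 ha hp.le hs has
  have hl := meshSize_pos d hs
  have hlq : meshSize d s ≤ Nat.sqrt s := meshSize_le_sqrt (by omega) hs
  have hqs : Nat.sqrt s ≤ s := Nat.sqrt_le_self s
  have hfl : (Nat.sqrt s + 1) * meshSize d s ≤ 2 * s := by
    have h1 := Nat.mul_le_mul_left (Nat.sqrt s + 1) hlq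
    have h2 := Nat.sqrt_le s
    have h3 : (Nat.sqrt s + 1) * Nat.sqrt s = Nat.sqrt s * Nat.sqrt s + Nat.sqrt s :=
      Nat.succ_mul _ _
    omega
  refine lasVegas_of_forall (by positivity) ?_ ?_
  · intro load hload t ht ω
    refine shiftSearch_withinLimits G _ _ _ T load hd0 hT hl (Nat.succ_pos _) hGw hload
      (by omega) (by omega) ?_ ?_ ?_ t ht ω
    · nlinarith
    · nlinarith
    · nlinarith
  · intro load hload ω
    obtain ⟨τ, hτ, hmin, hout⟩ := shiftSearch_outputs (mem := (d + k + 3) * s) (w := w) G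
      (fun τ (v : Fin d → ℕ) => decide (1 < s ∧ InWall (meshSize d s) c τ v)) (meshSize d s) (Nat.sqrt s + 1)
      T load hd0 hT hl hload ((machineCount_le hs).trans hpow)
    refine ⟨_, hout ω, ?_⟩
    simp only [decide_eq_true_eq] at hmin ⊢
    rcases Nat.lt_or_ge 1 s with h1s | h1s
    · simp only [h1s, true_and] at hmin ⊢
      refine G.isPseudoSeparator_of_walls hGc hs (by omega) hl (meshSize_pow_le hd0 s)
        (by linarith) ?_
      rw [hGn]
      exact card_walls_le G.nodes h1s hGn (by omega) (by omega) (by linarith) hmin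
    · obtain rfl : s = 1 := by omega
      simp only [lt_irrefl, false_and, Finset.filter_false]
      refine G.isPseudoSeparator_empty one_pos (by omega) ?_
      -- For `s = 1` the tree is binary, so its depth bounds `n` by `2 ^ T`.
      rw [Nat.sqrt_one] at hpow
      rw [hGn]
      have : (n : ℝ) ≤ (2 : ℝ) ^ T := by exact_mod_cast hpow
      linarith
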